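/- Let $\xi=\frac{3-\sqrt5}{2}$, let $n\ge 1$, let $0<\varepsilon<1$, put $r=\lceil \log_2\log_{1+\xi}\frac1\varepsilon\rceil$, and assume $r\ge -1$ (equivalently $\varepsilon<(1+\xi)^{-1/4}$). Let $\mathcal P_n$ be the set of all probability distributions $F$ of reward vectors $v=(v_1,\dots,v_n)\in\mathbb R_{\ge0}^n$ whose coordinates are pairwise independent. For $F\in\mathcal P_n$ call reals $T_0,T_1,T_2,\dots$ admissible thresholds if $$\sum_{i=1}^n\Pr[v_i>T_0]\le \xi\le\sum_{i=1}^n\Pr[v_i\ge T_0]$$ and, with $p=\Pr[\max_i v_i<T_0]$, for every $j\ge1$ the number $T_j$ is a $p^{2^j}$-quantile threshold of $\max_i v_i$, i.e. $\Pr[\max_i v_i<T_j]\le p^{2^j}\le \Pr[\max_i v_i\le T_j]$. Admissible thresholds exist for every $F\in\mathcal P_n$. Consider the following online algorithm $\mathrm{ALG}$, which is given $F$ and $\varepsilon$, fixes admissible thresholds for $F$, and observes one by one the rewards of rounds $v^{(1)},v^{(2)},\dots$ drawn independently from $F$. In rounds $1$ and $2$ it selects the first reward that is $>T_0$. If nothing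 was selected there, it continues with $r+2$ further rounds, and in the $s$-th of these ($s=1,\dots,r+2$) it selects the first reward that is $\ge T_{\max\{s-2,0\}}$. It stops after its first selection, its value is the selected reward, and its value is $0$ if nothing is selected (in particular, it ignores all rounds after the first $r+4$). Then, for every choice of admissible thresholds, the $(1-\varepsilon)$-competition complexity of $\mathrm{ALG}$ on $\mathcal P_n$, that is, the smallest positive integer $K$ such that for every $F\in\mathcal P_n$ and every $k\ge K$ $$\mathbb E_{v\sim F^k}[\mathrm{ALG}(v)]\ \ge\ (1-\varepsilon)\,\mathbb E_{v\sim F}\bigl[\max_i v_i\bigr],$$ is at most $r+4=\lceil \log_2\log_{1+\xi}\frac1\varepsilon\rceil+4$, independently of $n$. -/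

import Mathlib

open MeasureTheory ProbabilityTheory
open scoped NNReal ENNReal

noncomputable section

namespace Prophet

/-- A distribution on sequences of `n` non-negative rewards is a probability measure on
`Fin n → ℝ≥0`; this is the class of those whose rewards are pairwise independent. -/
def pairwiseIndependent (n : ℕ) : Set (Measure (Fin n → ℝ≥0)) :=
  {F | IsProbabilityMeasure F ∧
    Pairwise fun i j : Fin n => IndepFun (fun v : Fin n → ℝ≥0 => v i) (fun v => v j) F}

/-- The prophet's value `max_i v_i`. -/
def maxReward {n : ℕ} (v : Fin n → ℝ≥0) : ℝ≥0 := Finset.univ.sup v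

/-- An algorithm: it knows the distribution `F` of a round and the number `k` of rounds, and
`ALG F k v` is the value it gets on the realized rounds `v 0, …, v (k - 1)`
(`0` if nothing is selected). -/
abbrev Algorithm (n : ℕ) : Type :=
  Measure (Fin n → ℝ≥0) → (k : ℕ) → (Fin k → Fin n → ℝ≥0) → ℝ≥0

/-- For every `F` in the class and every `k ≥ K`, the expected value of the algorithm on `k`
independent rounds is at least `(1 - ε)` times the expected maximum of one round. The expectations
are those of non-negative variables and may be infinite. -/
def Suffices {n : ℕ} (C : Set (Measure (Fin n → ℝ≥0))) (ALG : Algorithm n) (ε : ℝ) (K : ℕ) :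
    Prop :=
  ∀ F ∈ C, ∀ k : ℕ, K ≤ k →
    ENNReal.ofReal (1 - ε) * ∫⁻ v, (maxReward v : ℝ≥0∞) ∂F
      ≤ ∫⁻ v, (ALG F k v : ℝ≥0∞) ∂(Measure.pi fun _ : Fin k => F)

/-- The `(1 - ε)`-competition complexity of `ALG` on the class `C`: the smallest positive integer
that suffices (`⊤` if there is none). -/
def competitionComplexity {n : ℕ} (C : Set (Measure (Fin n → ℝ≥0))) (ALG : Algorithm n)
    (ε : ℝ) : ℕ∞ :=
  ⨅ (K : ℕ) (_ : 0 < K ∧ Suffices C ALG ε K), (K : ℕ∞)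

/-- `T` is a `q`-quantile threshold of the law of `max_i v_i`, `v ∼ F`. -/
def IsMaxQuantile {n : ℕ} (F : Measure (Fin n → ℝ≥0)) (q T : ℝ) : Prop :=
  F.real {v | (maxReward v : ℝ) < T} ≤ q ∧ q ≤ F.real {v | (maxReward v : ℝ) ≤ T}

/-- The constant `ξ = (3 - √5) / 2`. -/
def xi : ℝ := (3 - √5) / 2

/-- `T 0, T 1, …` are thresholds that the algorithm may use on `F`:
`∑ i, Pr[v_i > T 0] ≤ ξ ≤ ∑ i, Pr[v_i ≥ T 0]`, and, with `p = Pr[max_i v_i < T 0]`, for `j ≥ 1`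
the number `T j` is a `p ^ (2 ^ j)`-quantile threshold of the law of the maximum. -/
def AreThresholds {n : ℕ} (F : Measure (Fin n → ℝ≥0)) (T : ℕ → ℝ) : Prop :=
  (∑ i, F.real {v | T 0 < (v i : ℝ)} ≤ xi ∧ xi ≤ ∑ i, F.real {v | T 0 ≤ (v i : ℝ)}) ∧
  ∀ j : ℕ, 1 ≤ j → IsMaxQuantile F (F.real {v | (maxReward v : ℝ) < T 0} ^ (2 ^ j)) (T j)

/-- The `n * k` rewards in their order of arrival, round after round, each with the number of its
round (rounds are numbered from `0`). -/
def arrivals {n k : ℕ} (v : Fin k → Fin n → ℝ≥0) : List (ℕ × ℝ≥0) :=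
  (List.finRange k).flatMap fun t : Fin k => List.ofFn fun i => ((t : ℕ), v t i)

open Classical in
/-- Observe the rewards one by one and select the first one that passes the test `P t` of its
round `t`; the value is `0` if there is none. -/
def scan {n k : ℕ} (P : ℕ → ℝ≥0 → Prop) (v : Fin k → Fin n → ℝ≥0) : ℝ≥0 :=
  ((arrivals v).find? fun a => decide (P a.1 a.2)).elim 0 Prod.snd

/-- The test in round `t`. The first phase consists of the rounds `t = 0, 1`, with the test
`x > T 0`. The second phase consists of the next `m` rounds, with the test `x ≥ T (max (s - 2) 0)`
in its `s`-th round, `s = 1, …, m`; as `s = t - 1`, the index is the truncated difference `t - 3`.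
No reward is accepted after that. -/
def accepts (T : ℕ → ℝ) (m : ℕ) (t : ℕ) (x : ℝ≥0) : Prop :=
  if t < 2 then T 0 < (x : ℝ) else t < 2 + m ∧ T (t - 3) ≤ (x : ℝ)

/-- `⌈log₂ log_{1+ξ} (1/ε)⌉`. -/
def rounds (ε : ℝ) : ℤ := ⌈Real.logb 2 (Real.logb (1 + xi) (1 / ε))⌉

/-- The two-phase algorithm with target approximation `ε`, where `T F` are the thresholds it uses
on `F`; the second phase has `⌈log₂ log_{1+ξ} (1/ε)⌉ + 2` rounds. -/
def twoPhase (n : ℕ) (T : Measure (Fin n → ℝ≥0) → ℕ → ℝ) (ε : ℝ) : Algorithm n :=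
  fun F _ v => scan (accepts (T F) (rounds ε + 2).toNat) v

end Prophet

end

open MeasureTheory ProbabilityTheory Filter Topology
open scoped NNReal ENNReal

/-! The algorithm's value beats `1 - ε` times the maximum tail by tail: for every real `t`, Pr[ALG >
t] ≥ (1 - ε) Pr[max > t] (`mul_real_lt_maxReward_le`), and integrating over `t > 0` gives the
expectations.

For `t ≥ T 0` the first phase suffices. Let S be the expected number of rewards above `t`. By
pairwise independence and a union bound, a round has exactly one reward above `T 0`, and that one
above `t`, with probability at least S(1 - ξ). This happens in the first round, or in the second
after an empty first one, with total probability at least S(1 - ξ)(2 - ξ) = S ≥ Pr[max > t]; ξ is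
the root of (1 - ξ)(2 - ξ) = 1 in (0, 1).

For `t < T 0` any selection made while the thresholds exceed `t` is good. If `T l` is the first
threshold that is at most `t`, then `l + 1` rounds of the second phase must fail, with probability
at most p · p · p^2 ⋯ p^(2^(l-1)) = p^(2^l), while Pr[max > t] ≤ 1 - p^(2^l) by the choice of `T l`.
If no threshold in use is that low, all `m` rounds must fail, with probability at most p^(2^(m-1)) ≤
ε, since p ≤ 1/(1 + ξ) by a second-moment bound (`real_forall_notMem_le`). -/

namespace Prophet

/-! ### Order of arrival and measurability of the selected reward -/

section Scan

variable {n k : ℕ}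

lemma mem_arrivals {v : Fin k → Fin n → ℝ≥0} {a : ℕ × ℝ≥0} :
    a ∈ arrivals v ↔ ∃ (t : Fin k) (i : Fin n), a = ((t : ℕ), v t i) := by
  simp only [arrivals, List.mem_flatMap, List.mem_finRange, true_and, List.mem_ofFn, eq_comm]

lemma arrivals_pairwise (v : Fin k → Fin n → ℝ≥0) :
    (arrivals v).Pairwise fun a b => a.1 ≤ b.1 := by
  rw [arrivals, List.pairwise_flatMap]
  refine ⟨fun t _ => ?_, ?_⟩
  · rw [List.pairwise_ofFn]
    intro i j _
    exact le_rfl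
  · refine (List.pairwise_lt_finRange k).imp ?_
    intro s t hst x hx y hy
    obtain ⟨i, rfl⟩ := List.mem_ofFn.1 hx
    obtain ⟨j, rfl⟩ := List.mem_ofFn.1 hy
    exact hst.le

/-- If some reward of round `s` is acceptable, the selected reward is an acceptable one from a round
no later than `s`. -/
lemma exists_scan_eq {P : ℕ → ℝ≥0 → Prop} {v : Fin k → Fin n → ℝ≥0} {s : Fin k} {i : Fin n}
    (h : P s (v s i)) :
    ∃ s' ≤ s, ∃ i', P s' (v s' i') ∧ scan P v = v s' i' := by
  classical
  have hmem : ((s : ℕ), v s i) ∈ arrivals v := mem_arrivals.2 ⟨s, i, rfl⟩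
  cases hf : (arrivals v).find? (fun a => decide (P a.1 a.2)) with
  | none =>
    rw [List.find?_eq_none] at hf
    exact absurd (by simpa using h) (hf _ hmem)
  | some b =>
    obtain ⟨hb, as, bs, hL, has⟩ := List.find?_eq_some_iff_append.1 hf
    have hbm : b ∈ arrivals v := by rw [hL]; simp
    obtain ⟨s', i', rfl⟩ := mem_arrivals.1 hbm
    -- The entry of round `s` cannot precede the selected one, as everything before it fails the
    -- test; rounds are non-decreasing along the list.
    have hle : s' ≤ s := by
      have hp := arrivals_pairwise v
      rw [hL] at hp hmem
      rcases List.mem_append.1 hmem with h1 | h1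
      · simpa [h] using has _ h1
      · rcases List.mem_cons.1 h1 with h2 | h2
        · exact Fin.le_def.2 (Prod.ext_iff.1 h2).1.ge
        · exact (List.pairwise_cons.1 (List.pairwise_append.1 hp).2.1).1 _ h2
    refine ⟨s', hle, i', by simpa using hb, ?_⟩
    simp only [scan]
    rw [show (arrivals v).find? _ = some ((s' : ℕ), v s' i') by convert hf]
    rfl

lemma measurable_find?_elim {Ω : Type*} [MeasurableSpace Ω] {P : ℕ → ℝ≥0 → Prop}
    [∀ t x, Decidable (P t x)] (hP : ∀ t, MeasurableSet {x | P t x}) (L : List (ℕ × (Ω → ℝ≥0)))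
    (hL : ∀ a ∈ L, Measurable a.2) :
    Measurable fun ω =>
      ((L.map fun a => (a.1, a.2 ω)).find? fun a => decide (P a.1 a.2)).elim 0 Prod.snd := by
  induction L with
  | nil => simp
  | cons a L ih =>
    have h1 := ih fun b hb => hL b (List.mem_cons_of_mem _ hb)
    have h2 := hL a List.mem_cons_self
    have : (fun ω => (((a :: L).map fun a => (a.1, a.2 ω)).find?
        fun a => decide (P a.1 a.2)).elim 0 Prod.snd) = fun ω => if P a.1 (a.2 ω) then a.2 ω else
        ((L.map fun a => (a.1, a.2 ω)).find? fun a => decide (P a.1 a.2)).elim 0 Prod.snd := by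
      funext ω
      by_cases h : P a.1 (a.2 ω) <;> simp [h]
    rw [this]
    exact Measurable.ite (h2 (hP a.1)) h2 h1

lemma measurable_scan {P : ℕ → ℝ≥0 → Prop} (hP : ∀ t, MeasurableSet {x | P t x}) :
    Measurable fun v : Fin k → Fin n → ℝ≥0 => scan P v := by
  classical
  have := measurable_find?_elim hP
    ((List.finRange k).flatMap fun t : Fin k =>
      List.ofFn fun i : Fin n => ((t : ℕ), fun v : Fin k → Fin n → ℝ≥0 => v t i)) (by
      intro a ha
      simp only [List.mem_flatMap, List.mem_finRange, true_and, List.mem_ofFn] at ha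
      obtain ⟨t, i, rfl⟩ := ha
      exact (measurable_pi_apply i).comp (measurable_pi_apply t))
  convert this using 2 with v
  simp only [scan, arrivals, List.map_flatMap, List.map_ofFn, Function.comp_def]

end Scan

/-! ### Existence of quantiles -/

section Quantile

/-- Upper quantiles of a finite measure on the line. -/
lemma exists_quantile (ν : Measure ℝ) [IsFiniteMeasure ν] {c : ℝ} (hc : 0 < c)
    (hc' : c ≤ ν.real (Set.Ici 0)) :
    ∃ T : ℝ, ν.real (Set.Ioi T) ≤ c ∧ c ≤ ν.real (Set.Ici T) := by
  set S : Set ℝ := {T | c ≤ ν.real (Set.Ici T)} with hS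
  have hanti : ∀ {a b : ℝ}, a ≤ b → ν.real (Set.Ici b) ≤ ν.real (Set.Ici a) := fun h =>
    measureReal_mono (Set.Ici_subset_Ici.2 h)
  have hreal : ∀ {u : ℕ → Set ℝ} {s : Set ℝ}, Tendsto (fun m => ν (u m)) atTop (𝓝 (ν s)) →
      Tendsto (fun m => ν.real (u m)) atTop (𝓝 (ν.real s)) := fun h =>
    (ENNReal.tendsto_toReal (measure_ne_top ν _)).comp h
  have hbdd : BddAbove S := by
    have h1 : Tendsto (fun m : ℕ => ν.real (Set.Ici (m : ℝ))) atTop (𝓝 (ν.real (∅ : Set ℝ))) := by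
      refine hreal ?_
      have : (∅ : Set ℝ) = ⋂ m : ℕ, Set.Ici (m : ℝ) := by
        refine (Set.eq_empty_of_forall_notMem fun x hx => ?_).symm
        obtain ⟨m, hm⟩ := exists_nat_gt x
        exact absurd (Set.mem_iInter.1 hx m) (not_le.2 hm)
      rw [this]
      exact tendsto_measure_iInter_atTop (fun m => measurableSet_Ici.nullMeasurableSet)
        (fun a b h => Set.Ici_subset_Ici.2 (by exact_mod_cast h)) ⟨0, measure_ne_top ν _⟩
    rw [measureReal_empty] at h1
    obtain ⟨m, hm⟩ := (h1.eventually (gt_mem_nhds hc)).exists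
    refine ⟨m, fun T hT => ?_⟩
    by_contra! h
    exact absurd (hT.trans (hanti h.le)) (not_le.2 hm)
  have hpos : ∀ m : ℕ, (0 : ℝ) < 1 / ((m : ℝ) + 1) := fun m => Nat.one_div_pos_of_nat
  -- The supremum works: continuity of the measure along increasing unions bounds the open ray, and
  -- along decreasing intersections the closed one.
  refine ⟨sSup S, ?_, ?_⟩
  · have h1 : Tendsto (fun m : ℕ => ν.real (Set.Ici (sSup S + 1 / ((m : ℝ) + 1)))) atTop
        (𝓝 (ν.real (Set.Ioi (sSup S)))) := by
      refine hreal ?_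
      have : Set.Ioi (sSup S) = ⋃ m : ℕ, Set.Ici (sSup S + 1 / ((m : ℝ) + 1)) := by
        ext x
        simp only [Set.mem_Ioi, Set.mem_iUnion, Set.mem_Ici]
        constructor
        · intro hx
          obtain ⟨m, hm⟩ := exists_nat_one_div_lt (sub_pos.2 hx)
          exact ⟨m, by linarith⟩
        · rintro ⟨m, hm⟩
          linarith [hpos m]
      rw [this]
      exact tendsto_measure_iUnion_atTop fun a b h => Set.Ici_subset_Ici.2
        (by linarith [Nat.one_div_le_one_div (α := ℝ) h])
    refine le_of_tendsto' h1 fun m => ?_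
    by_contra! h
    linarith [le_csSup hbdd (show sSup S + 1 / ((m : ℝ) + 1) ∈ S from h.le), hpos m]
  · have h1 : Tendsto (fun m : ℕ => ν.real (Set.Ici (sSup S - 1 / ((m : ℝ) + 1)))) atTop
        (𝓝 (ν.real (Set.Ici (sSup S)))) := by
      refine hreal ?_
      have : Set.Ici (sSup S) = ⋂ m : ℕ, Set.Ici (sSup S - 1 / ((m : ℝ) + 1)) := by
        ext x
        simp only [Set.mem_Ici, Set.mem_iInter]
        constructor
        · intro hx m
          linarith [hpos m]
        · intro hx
          by_contra! h
          obtain ⟨m, hm⟩ := exists_nat_one_div_lt (sub_pos.2 h)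
          linarith [hx m]
      rw [this]
      exact tendsto_measure_iInter_atTop (fun m => measurableSet_Ici.nullMeasurableSet)
        (fun a b h => Set.Ici_subset_Ici.2 (by linarith [Nat.one_div_le_one_div (α := ℝ) h]))
        ⟨0, measure_ne_top ν _⟩
    refine ge_of_tendsto' h1 fun m => ?_
    obtain ⟨T, hT, hlt⟩ := exists_lt_of_lt_csSup (⟨0, hc'⟩ : S.Nonempty)
      (sub_lt_self (sSup S) (hpos m))
    exact le_trans hT (hanti hlt.le)

/-- A common upper quantile of finitely many non-negative random variables. -/
lemma exists_sum_quantile {Ω ι : Type*} [MeasurableSpace Ω] (F : Measure Ω) [IsFiniteMeasure F]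
    (s : Finset ι) (f : ι → Ω → ℝ) (hf : ∀ i, Measurable (f i)) (h0 : ∀ i ω, 0 ≤ f i ω) {c : ℝ}
    (hc : 0 < c) (hc' : c ≤ s.card * F.real Set.univ) :
    ∃ T : ℝ, ∑ i ∈ s, F.real {ω | T < f i ω} ≤ c ∧ c ≤ ∑ i ∈ s, F.real {ω | T ≤ f i ω} := by
  -- Summing the laws turns a common quantile into a quantile of one finite measure.
  set ν : Measure ℝ := ∑ i ∈ s, F.map (f i) with hν
  have hreal : ∀ A : Set ℝ, MeasurableSet A →
      ν.real A = ∑ i ∈ s, F.real (f i ⁻¹' A) := by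
    intro A hA
    rw [measureReal_def, hν, Measure.finsetSum_apply,
      ENNReal.toReal_sum fun i _ => measure_ne_top _ _]
    exact Finset.sum_congr rfl fun i _ => by rw [Measure.map_apply (hf i) hA, measureReal_def]
  obtain ⟨T, h1, h2⟩ := exists_quantile ν hc (by
    rw [hreal _ measurableSet_Ici]
    have : ∀ i, f i ⁻¹' Set.Ici 0 = Set.univ := fun i => Set.eq_univ_of_forall (h0 i)
    simpa [this] using hc')
  rw [hreal _ measurableSet_Ioi] at h1
  rw [hreal _ measurableSet_Ici] at h2
  exact ⟨T, h1, h2⟩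

end Quantile

/-! ### Arithmetic of ξ and of the number of rounds -/

section Constant

lemma sq_sqrt_five : √5 ^ 2 = 5 := Real.sq_sqrt (by norm_num)

lemma xi_pos : 0 < xi := by
  have h1 : √5 < 3 := by
    rw [Real.sqrt_lt' (by norm_num)]
    norm_num
  unfold xi
  linarith

lemma xi_lt_one : xi < 1 := by
  have h1 : 1 < √5 := by
    rw [Real.lt_sqrt (by norm_num)]
    norm_num
  unfold xi
  linarith

lemma one_sub_xi_mul_two_sub_xi : (1 - xi) * (2 - xi) = 1 := by
  unfold xi
  nlinarith [sq_sqrt_five]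

/-- Bounds the probability that the whole second phase fails. The exponent is 2^(r+1), although 2^r
would already be enough by the definition of r as a ceiling. -/
lemma inv_one_add_xi_pow_le {ε : ℝ} (hε0 : 0 < ε) (hε1 : ε < 1) (hr : -1 ≤ rounds ε) :
    (1 / (1 + xi)) ^ 2 ^ ((rounds ε + 2).toNat - 1) ≤ ε := by
  have hx := xi_pos
  have hb : 1 < 1 + xi := by linarith
  have hL : 0 < Real.logb (1 + xi) (1 / ε) :=
    Real.logb_pos hb (by rw [lt_div_iff₀ hε0]; linarith)
  set N := (rounds ε + 2).toNat - 1 with hN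
  have hNr : (rounds ε : ℝ) ≤ N := by
    have : rounds ε ≤ (N : ℤ) := by omega
    exact_mod_cast this
  have h1 : Real.logb 2 (Real.logb (1 + xi) (1 / ε)) ≤ N := (Int.le_ceil _).trans hNr
  rw [Real.logb_le_iff_le_rpow (by norm_num) hL, Real.rpow_natCast] at h1
  rw [Real.logb_le_iff_le_rpow hb (by positivity)] at h1
  have h2 : 1 / ε ≤ (1 + xi) ^ (2 ^ N) := by
    rw [← Real.rpow_natCast]
    exact_mod_cast h1
  rw [div_pow, one_pow]
  exact (one_div_le hε0 (by positivity)).1 h2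

end Constant

/-! ### Probability estimates within one round -/

section OneRound

variable {n : ℕ} {F : Measure (Fin n → ℝ≥0)}

lemma le_maxReward (v : Fin n → ℝ≥0) (i : Fin n) : (v i : ℝ) ≤ maxReward v :=
  NNReal.coe_le_coe.2 (Finset.le_sup (Finset.mem_univ i))

lemma exists_eq_maxReward [NeZero n] (v : Fin n → ℝ≥0) : ∃ i, maxReward v = v i := by
  obtain ⟨i, -, h⟩ := Finset.exists_mem_eq_sup Finset.univ Finset.univ_nonempty v
  exact ⟨i, h⟩

lemma measurable_maxReward : Measurable (maxReward : (Fin n → ℝ≥0) → ℝ≥0) := by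
  refine measurable_of_Iic fun a => ?_
  have : maxReward ⁻¹' Set.Iic a = ⋂ i, {v : Fin n → ℝ≥0 | v i ≤ a} := by
    ext v
    simp [maxReward]
  rw [this]
  exact MeasurableSet.iInter fun i => measurable_pi_apply i measurableSet_Iic

lemma measurable_coe_apply (i : Fin n) : Measurable fun v : Fin n → ℝ≥0 => (v i : ℝ) :=
  measurable_coe_nnreal_real.comp (measurable_pi_apply i)

lemma measurable_coe_maxReward : Measurable fun v : Fin n → ℝ≥0 => (maxReward v : ℝ) :=
  measurable_coe_nnreal_real.comp measurable_maxReward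

lemma real_inter_eq_mul (hF : F ∈ pairwiseIndependent n) {i j : Fin n} (hij : i ≠ j)
    {A B : Set ℝ} (hA : MeasurableSet A) (hB : MeasurableSet B) :
    F.real ({v | (v i : ℝ) ∈ A} ∩ {v | (v j : ℝ) ∈ B})
      = F.real {v | (v i : ℝ) ∈ A} * F.real {v | (v j : ℝ) ∈ B} := by
  have := (hF.2 hij).measure_inter_preimage_eq_mul _ _ (measurable_coe_nnreal_real hA)
    (measurable_coe_nnreal_real hB)
  simp only [measureReal_def, ← ENNReal.toReal_mul]
  exact congrArg ENNReal.toReal this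

/-- Second-moment bound: if the expected number of rewards in `A` is at least `c`, the probability
that there is none is at most `1 / (1 + c)`. -/
lemma real_forall_notMem_le (hF : F ∈ pairwiseIndependent n) {A : Set ℝ} (hA : MeasurableSet A)
    {c : ℝ} (hc : 0 < c) (hsum : c ≤ ∑ i, F.real {v | (v i : ℝ) ∈ A}) :
    F.real {v | ∀ i, (v i : ℝ) ∉ A} ≤ 1 / (1 + c) := by
  have := hF.1
  set E : Fin n → Set (Fin n → ℝ≥0) := fun i => {v | (v i : ℝ) ∈ A} with hE
  have hEm : ∀ i, MeasurableSet (E i) := fun i => measurable_coe_apply i hA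
  set s := ∑ i, F.real (E i) with hs
  have hs0 : 0 < s := hc.trans_le hsum
  set Z : Set (Fin n → ℝ≥0) := {v | ∀ i, (v i : ℝ) ∉ A} with hZ
  have hZm : MeasurableSet Z := by
    have : Z = ⋂ i, (E i)ᶜ := by ext v; simp [hZ, hE]
    rw [this]
    exact MeasurableSet.iInter fun i => (hEm i).compl
  -- With X the number of rewards in `A`, the indicator of X = 0 is at most (1 - dX)^2. This `d`
  -- minimizes the bound 1 - 2ds + d^2(s + s^2) on its expectation.
  set d := 1 / (1 + s) with hd
  have hint : ∀ S : Set (Fin n → ℝ≥0), MeasurableSet S →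
      Integrable (S.indicator (fun _ => (1 : ℝ))) F := fun S hS =>
    (integrable_const (1 : ℝ)).indicator hS
  have hpt : ∀ v, Z.indicator (fun _ => (1 : ℝ)) v ≤
      1 - 2 * d * ∑ i, (E i).indicator (fun _ => (1 : ℝ)) v
        + d ^ 2 * ∑ i, ∑ j, (E i ∩ E j).indicator (fun _ => (1 : ℝ)) v := by
    intro v
    have hprod : ∑ i, ∑ j, (E i ∩ E j).indicator (fun _ => (1 : ℝ)) v
        = (∑ i, (E i).indicator (fun _ => (1 : ℝ)) v) ^ 2 := by
      rw [sq, Finset.sum_mul_sum]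
      refine Finset.sum_congr rfl fun i _ => Finset.sum_congr rfl fun j _ => ?_
      by_cases h1 : v ∈ E i <;> by_cases h2 : v ∈ E j <;> simp [h1, h2]
    rw [hprod]
    by_cases hv : v ∈ Z
    · have : ∑ i, (E i).indicator (fun _ => (1 : ℝ)) v = 0 :=
        Finset.sum_eq_zero fun i _ => Set.indicator_of_notMem (show v ∉ E i from hv i) _
      simp [this, hv]
    · rw [Set.indicator_of_notMem hv]
      nlinarith [sq_nonneg (1 - d * ∑ i, (E i).indicator (fun _ => (1 : ℝ)) v)]
  have hI1 : Integrable (fun v => ∑ i, (E i).indicator (fun _ => (1 : ℝ)) v) F :=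
    integrable_finsetSum _ fun i _ => hint _ (hEm i)
  have hI2 : Integrable (fun v => ∑ i, ∑ j, (E i ∩ E j).indicator (fun _ => (1 : ℝ)) v) F :=
    integrable_finsetSum _ fun i _ => integrable_finsetSum _ fun j _ =>
      hint _ ((hEm i).inter (hEm j))
  have key := integral_mono (hint Z hZm)
    (((integrable_const (1 : ℝ)).sub (hI1.const_mul (2 * d))).add (hI2.const_mul (d ^ 2))) hpt
  have e1 : ∫ v, ∑ i, (E i).indicator (fun _ => (1 : ℝ)) v ∂F = s := by
    rw [integral_finsetSum _ fun i _ => hint _ (hEm i)]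
    exact Finset.sum_congr rfl fun i _ => integral_indicator_one (hEm i)
  have e2 : ∫ v, ∑ i, ∑ j, (E i ∩ E j).indicator (fun _ => (1 : ℝ)) v ∂F ≤ s + s ^ 2 := by
    rw [integral_finsetSum _ fun i _ => integrable_finsetSum _ fun j _ =>
      hint _ ((hEm i).inter (hEm j))]
    rw [sq, hs, Finset.sum_mul, ← Finset.sum_add_distrib]
    refine Finset.sum_le_sum fun i _ => ?_
    rw [integral_finsetSum _ fun j _ => hint _ ((hEm i).inter (hEm j))]
    -- Only pairs enter the second moment, so pairwise independence handles the off-diagonal terms;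
    -- the diagonal contributes the extra `s`.
    have : ∀ j, ∫ v, (E i ∩ E j).indicator (fun _ => (1 : ℝ)) v ∂F
        ≤ (if j = i then F.real (E i) else 0) + F.real (E i) * F.real (E j) := by
      intro j
      have h1 : ∫ v, (E i ∩ E j).indicator (fun _ => (1 : ℝ)) v ∂F = F.real (E i ∩ E j) :=
        integral_indicator_one ((hEm i).inter (hEm j))
      rw [h1]
      by_cases hij : j = i
      · subst hij
        simp only [Set.inter_self, if_true, le_add_iff_nonneg_right]
        positivity
      · rw [if_neg hij, zero_add]
        exact (real_inter_eq_mul hF (Ne.symm hij) hA hA).le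
    refine (Finset.sum_le_sum fun j _ => this j).trans_eq ?_
    rw [Finset.sum_add_distrib, Finset.sum_ite_eq' Finset.univ i, if_pos (Finset.mem_univ i),
      Finset.mul_sum]
  have e0 : ∫ v, Z.indicator (fun _ => (1 : ℝ)) v ∂F = F.real Z := integral_indicator_one hZm
  have e3 : ∫ v, ((1 : ℝ) - 2 * d * ∑ i, (E i).indicator (fun _ => (1 : ℝ)) v
        + d ^ 2 * ∑ i, ∑ j, (E i ∩ E j).indicator (fun _ => (1 : ℝ)) v) ∂F
      = 1 - 2 * d * s + d ^ 2 *
        ∫ v, ∑ i, ∑ j, (E i ∩ E j).indicator (fun _ => (1 : ℝ)) v ∂F := by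
    have h := (integrable_const (μ := F) (1 : ℝ)).sub (hI1.const_mul (2 * d))
    simp only [Pi.sub_def] at h
    rw [integral_add h (hI2.const_mul (d ^ 2)), integral_sub (integrable_const (1 : ℝ)) (hI1.const_mul (2 * d)),
      integral_const_mul, integral_const_mul, e1]
    simp
  have h3 : F.real Z ≤ 1 - 2 * d * s + d ^ 2 * (s + s ^ 2) := by
    rw [← e0]
    refine key.trans ?_
    refine (le_of_eq e3).trans ?_
    gcongr
  have h4 : 1 - 2 * d * s + d ^ 2 * (s + s ^ 2) = 1 / (1 + s) := by
    rw [hd]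
    field_simp
    ring
  rw [h4] at h3
  exact h3.trans (one_div_le_one_div_of_le (by linarith) (by linarith))

/-- The rewards in a round of which exactly one exceeds `a`, and this one even exceeds `b`. -/
def uniqueExceed (n : ℕ) (a b : ℝ) : Set (Fin n → ℝ≥0) :=
  {v | ∃ i, b < (v i : ℝ) ∧ ∀ j, j ≠ i → (v j : ℝ) ≤ a}

lemma measurableSet_uniqueExceed (a b : ℝ) : MeasurableSet (uniqueExceed n a b) := by
  have : uniqueExceed n a b = ⋃ i, {v : Fin n → ℝ≥0 | b < (v i : ℝ)} ∩
      ⋂ j, ⋂ (_ : j ≠ i), {v : Fin n → ℝ≥0 | (v j : ℝ) ≤ a} := by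
    ext v
    simp [uniqueExceed]
  rw [this]
  exact MeasurableSet.iUnion fun i => (measurable_coe_apply i measurableSet_Ioi).inter
    (MeasurableSet.iInter fun j => MeasurableSet.iInter fun _ =>
      measurable_coe_apply j measurableSet_Iic)

/-- The events, one for each possible position of the single large reward, are disjoint. From each,
a union bound over the other rewards removes only pair intersections, which factor. -/
lemma sum_mul_le_real_uniqueExceed (hF : F ∈ pairwiseIndependent n) {a b : ℝ} (hab : a ≤ b) :
    (∑ i, F.real {v | b < (v i : ℝ)}) * (1 - ∑ i, F.real {v | a < (v i : ℝ)})
      ≤ F.real (uniqueExceed n a b) := by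
  have := hF.1
  set D : Fin n → Set (Fin n → ℝ≥0) := fun i =>
    {v | b < (v i : ℝ)} \ ⋃ j ∈ Finset.univ.erase i, {v | a < (v j : ℝ)} with hD
  have hDm : ∀ i, MeasurableSet (D i) := fun i =>
    (measurable_coe_apply i measurableSet_Ioi).diff
      (Finset.measurableSet_biUnion _ fun j _ => measurable_coe_apply j measurableSet_Ioi)
  have hdisj : Pairwise (Function.onFun Disjoint D) := by
    intro i j hij
    refine Set.disjoint_left.2 fun v hi hj => hj.2 ?_
    simp only [Set.mem_iUnion, Finset.mem_erase, Finset.mem_univ, and_true, exists_prop]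
    exact ⟨i, hij, lt_of_le_of_lt hab hi.1⟩
  have hU : uniqueExceed n a b = ⋃ i, D i := by
    ext v
    simp [uniqueExceed, hD]
  rw [hU, measureReal_iUnion_fintype hdisj hDm, Finset.sum_mul]
  refine Finset.sum_le_sum fun i _ => ?_
  set B : Set (Fin n → ℝ≥0) := {v | b < (v i : ℝ)} with hB
  have h1 : F.real B ≤ F.real (D i) +
      F.real (⋃ j ∈ Finset.univ.erase i, (B ∩ {v | a < (v j : ℝ)})) := by
    refine (measureReal_mono ?_).trans (measureReal_union_le _ _)
    intro v hv
    by_cases h : v ∈ D i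
    · exact Or.inl h
    · right
      have : v ∈ ⋃ j ∈ Finset.univ.erase i, {v : Fin n → ℝ≥0 | a < (v j : ℝ)} := by
        by_contra h'
        exact h ⟨hv, h'⟩
      simp only [Set.mem_iUnion, exists_prop] at this ⊢
      obtain ⟨j, hj, hvj⟩ := this
      exact ⟨j, hj, hv, hvj⟩
  have h2 : F.real (⋃ j ∈ Finset.univ.erase i, (B ∩ {v | a < (v j : ℝ)}))
      ≤ F.real B * ∑ j, F.real {v | a < (v j : ℝ)} := by
    refine (measureReal_biUnion_finset_le _ _).trans ?_
    rw [Finset.mul_sum]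
    refine le_trans (Finset.sum_le_sum fun j hj => ?_)
      (Finset.sum_le_sum_of_subset_of_nonneg (Finset.erase_subset i Finset.univ)
        fun j _ _ => by positivity)
    exact (real_inter_eq_mul hF (Finset.ne_of_mem_erase hj).symm
      measurableSet_Ioi measurableSet_Ioi).le
  linarith

end OneRound

/-! ### Existence of admissible thresholds -/

section Existence

lemma exists_areThresholds {n : ℕ} [NeZero n] {F : Measure (Fin n → ℝ≥0)}
    (hF : F ∈ pairwiseIndependent n) : ∃ T : ℕ → ℝ, AreThresholds F T := by
  have := hF.1
  have hn1 : (1 : ℝ) ≤ n := by exact_mod_cast NeZero.one_le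
  obtain ⟨T₀, h1, h2⟩ := exists_sum_quantile F Finset.univ (fun (i : Fin n) v => (v i : ℝ))
    measurable_coe_apply (fun i v => NNReal.coe_nonneg _) xi_pos
    (by simpa using xi_lt_one.le.trans hn1)
  set p := F.real {v | (maxReward v : ℝ) < T₀} with hp
  have hp0 : 0 ≤ p := measureReal_nonneg
  -- Strictness makes 1 - p^(2^j) positive, as the existence of upper quantiles requires.
  have hp1 : p < 1 := by
    refine (measureReal_mono fun v hv i => ?_).trans_lt
      ((real_forall_notMem_le hF measurableSet_Ici xi_pos h2).trans_lt ?_)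
    · exact not_le.2 ((le_maxReward v i).trans_lt hv)
    · rw [div_lt_one (by linarith [xi_pos])]
      linarith [xi_pos]
  have hq : ∀ j : ℕ, ∃ t, IsMaxQuantile F (p ^ 2 ^ j) t := by
    intro j
    have hlt : p ^ 2 ^ j < 1 := pow_lt_one₀ hp0 hp1 (by positivity)
    -- A lower q-quantile of the maximum is an upper (1 - q)-quantile, here a sum over a single
    -- index.
    obtain ⟨t, h3, h4⟩ := exists_sum_quantile F ({()} : Finset Unit)
      (fun _ v => (maxReward v : ℝ)) (fun _ => measurable_coe_maxReward)
      (fun _ v => NNReal.coe_nonneg _) (sub_pos.2 hlt)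
      (by simpa using pow_nonneg hp0 _)
    simp only [Finset.sum_singleton] at h3 h4
    have h5 := probReal_compl_eq_one_sub (μ := F)
      (measurable_coe_maxReward (measurableSet_Ioi (a := t)))
    have h6 := probReal_compl_eq_one_sub (μ := F)
      (measurable_coe_maxReward (measurableSet_Ici (a := t)))
    rw [← Set.preimage_compl, Set.compl_Ioi] at h5
    rw [← Set.preimage_compl, Set.compl_Ici] at h6
    exact ⟨t, h6.trans_le (sub_le_comm.1 h4), (le_sub_comm.1 h3).trans_eq h5.symm⟩
  choose t ht using hq
  refine ⟨fun j => if j = 0 then T₀ else t j, ⟨by simpa using h1, by simpa using h2⟩, ?_⟩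
  intro j hj
  simpa [Nat.one_le_iff_ne_zero.1 hj] using ht j

end Existence

/-! ### Tail comparison over several rounds -/

section Rounds

variable {n k : ℕ} {F : Measure (Fin n → ℝ≥0)}

lemma real_pi_univ_pi [IsProbabilityMeasure F] (B : Fin k → Set (Fin n → ℝ≥0)) :
    (Measure.pi fun _ : Fin k => F).real (Set.univ.pi B) = ∏ s, F.real (B s) := by
  simp only [measureReal_def, Measure.pi_pi, ENNReal.toReal_prod]

lemma measurableSet_accepts (T : ℕ → ℝ) (m t : ℕ) : MeasurableSet {x | accepts T m t x} := by
  unfold accepts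
  split_ifs
  · exact measurable_coe_nnreal_real measurableSet_Ioi
  · exact (MeasurableSet.const _).inter (measurable_coe_nnreal_real measurableSet_Ici)

/-- Above the first threshold, the first phase alone beats the tail of the maximum. -/
lemma real_lt_maxReward_le_of_le [NeZero n] (hF : F ∈ pairwiseIndependent n) {T : ℕ → ℝ}
    (hT : AreThresholds F T) (m : ℕ) (hk : 2 ≤ k) {t : ℝ} (ht : T 0 ≤ t) :
    F.real {v | t < (maxReward v : ℝ)} ≤
      (Measure.pi fun _ : Fin k => F).real {v | t < (scan (accepts T m) v : ℝ)} := by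
  have := hF.1
  obtain ⟨k, rfl⟩ := Nat.exists_eq_add_of_le' hk
  set S := ∑ i, F.real {v | t < (v i : ℝ)} with hS
  set q := ∑ i, F.real {v | T 0 < (v i : ℝ)} with hq
  have hqx : q ≤ xi := hT.1.1
  have hS0 : 0 ≤ S := Finset.sum_nonneg fun i _ => measureReal_nonneg
  have hunion : ∀ a : ℝ, F.real {v | a < (maxReward v : ℝ)} ≤ ∑ i, F.real {v | a < (v i : ℝ)} := by
    intro a
    refine (measureReal_mono ?_).trans (measureReal_iUnion_fintype_le _)
    intro v hv
    obtain ⟨i, hi⟩ := exists_eq_maxReward v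
    exact Set.mem_iUnion.2 ⟨i, by simpa [hi] using hv⟩
  set D := uniqueExceed n (T 0) t with hD
  set N : Set (Fin n → ℝ≥0) := {v | (maxReward v : ℝ) ≤ T 0} with hN
  have hDm : MeasurableSet D := measurableSet_uniqueExceed _ _
  have hNm : MeasurableSet N := measurable_coe_maxReward measurableSet_Iic
  have hNF : 1 - xi ≤ F.real N := by
    have h := probReal_compl_eq_one_sub (μ := F)
      (measurable_coe_maxReward (measurableSet_Ioi (a := T 0)))
    rw [← Set.preimage_compl, Set.compl_Ioi] at h
    have h' := hunion (T 0)
    have : F.real N = 1 - F.real {v | T 0 < (maxReward v : ℝ)} := h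
    linarith
  have hDF : S * (1 - xi) ≤ F.real D :=
    (mul_le_mul_of_nonneg_left (by linarith) hS0).trans (sum_mul_le_real_uniqueExceed hF ht)
  have hnotN : ∀ v ∈ D, v ∉ N := by
    rintro v ⟨i, hi, -⟩ hv
    exact absurd ((le_maxReward v i).trans hv) (not_le.2 (ht.trans_lt hi))
  -- Two disjoint ways to win: `D` in the first round, or an empty first round and `D` in the
  -- second.
  set B₁ : Fin (k + 2) → Set (Fin n → ℝ≥0) := Fin.cons D fun _ => Set.univ with hB₁
  set B₂ : Fin (k + 2) → Set (Fin n → ℝ≥0) :=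
    Fin.cons N (Fin.cons D fun _ => Set.univ) with hB₂
  have hB₂m : MeasurableSet (Set.univ.pi B₂) := by
    refine MeasurableSet.univ_pi fun s => ?_
    refine Fin.cases ?_ (fun s => Fin.cases ?_ (fun s => ?_) s) s
    · exact hNm
    · exact hDm
    · exact MeasurableSet.univ
  have hm₁ : (Measure.pi fun _ : Fin (k + 2) => F).real (Set.univ.pi B₁) = F.real D := by
    rw [real_pi_univ_pi, Fin.prod_univ_succ]
    simp [hB₁]
  have hm₂ : (Measure.pi fun _ : Fin (k + 2) => F).real (Set.univ.pi B₂)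
      = F.real N * F.real D := by
    rw [real_pi_univ_pi, Fin.prod_univ_succ, Fin.prod_univ_succ]
    simp [hB₂]
  have hdisj : Disjoint (Set.univ.pi B₁) (Set.univ.pi B₂) := by
    refine Set.disjoint_left.2 fun v h1 h2 => ?_
    exact hnotN (v 0) (h1 0 trivial) (h2 0 trivial)
  have hsel : ∀ (v : Fin (k + 2) → Fin n → ℝ≥0) (s : Fin (k + 2)), (s : ℕ) < 2 → v s ∈ D →
      (∀ s' < s, v s' ∈ N) → t < (scan (accepts T m) v : ℝ) := by
    rintro v s hs ⟨i, hi, hne⟩ hlt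
    have hacc : accepts T m s (v s i) := by
      rw [accepts, if_pos hs]
      exact ht.trans_lt hi
    obtain ⟨s', hs', i', h1, h2⟩ := exists_scan_eq hacc
    rw [accepts, if_pos (lt_of_le_of_lt (Fin.le_def.1 hs') hs)] at h1
    rw [h2]
    rcases hs'.lt_or_eq with h3 | rfl
    · exact absurd ((le_maxReward _ i').trans (hlt s' h3)) (not_le.2 h1)
    · by_cases hii : i' = i
      · rw [hii]
        exact hi
      · exact absurd (hne i' hii) (not_le.2 h1)
  have hsub : Set.univ.pi B₁ ∪ Set.univ.pi B₂ ⊆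
      {v | t < (scan (accepts T m) v : ℝ)} := by
    rintro v (h | h)
    · exact hsel v 0 (by simp) (h 0 trivial) fun s' hs' => absurd hs' (Fin.not_lt_zero s')
    · refine hsel v 1 (by simp) (h 1 trivial) fun s' hs' => ?_
      have : s' = 0 := by
        ext
        have := Fin.lt_def.1 hs'
        simp at this ⊢
        omega
      rw [this]
      exact h 0 trivial
  have h1 := measureReal_mono (μ := Measure.pi fun _ : Fin (k + 2) => F) hsub
  rw [measureReal_union hdisj hB₂m, hm₁, hm₂] at h1
  refine (hunion t).trans (le_trans ?_ h1)
  have hx := xi_lt_one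
  calc S = S * (1 - xi) * (1 + (1 - xi)) := by
        linear_combination -S * one_sub_xi_mul_two_sub_xi
    _ ≤ F.real D * (1 + F.real N) := by
        gcongr
    _ = F.real D + F.real N * F.real D := by ring

/-- The extra leading `p` completes the geometric sum of exponents 1 + (1 + 2 + ⋯ + 2^(l-1)) to 2^l;
this is why `T 0` is used in two rounds of the second phase. -/
lemma mul_prod_pow_two_pow (p : ℝ) (l : ℕ) :
    p * ∏ i ∈ Finset.range l, p ^ 2 ^ i = p ^ 2 ^ l := by
  induction l with
  | zero => simp
  | succ l ih => rw [Finset.prod_range_succ, ← mul_assoc, ih, ← pow_add, pow_succ 2 l, mul_two]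

/-- If `t` is below the thresholds of the first `l + 1` rounds of the second phase, the selected
reward exceeds `t` unless all of these rounds fail. -/
lemma one_sub_pow_le_real_lt_scan [NeZero n] (hF : F ∈ pairwiseIndependent n) {T : ℕ → ℝ}
    (hT : AreThresholds F T) {m l : ℕ} (hl : l < m) (hk : l + 3 ≤ k) {t : ℝ} (h0 : t < T 0)
    (hlt : ∀ i < l, t < T i) :
    1 - F.real {v | (maxReward v : ℝ) < T 0} ^ 2 ^ l ≤
      (Measure.pi fun _ : Fin k => F).real {v | t < (scan (accepts T m) v : ℝ)} := by
  have := hF.1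
  set p := F.real {v | (maxReward v : ℝ) < T 0} with hp
  have hp0 : 0 ≤ p := measureReal_nonneg
  -- Failure in the first `l + 1` rounds of the second phase, numbered 2 to `l + 2`. Truncated
  -- subtraction gives `T 0` in both rounds 2 and 3.
  set B : ℕ → Set (Fin n → ℝ≥0) := fun s =>
    if 2 ≤ s ∧ s < l + 3 then {v | (maxReward v : ℝ) < T (s - 3)} else Set.univ with hB
  have hlt' : ∀ s < l + 3, t < T (s - 3) := by
    intro s hs
    rcases Nat.eq_zero_or_pos (s - 3) with h | h
    · rw [h]
      exact h0
    · exact hlt _ (by omega)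
  have hsub : {v : Fin k → Fin n → ℝ≥0 | t < (scan (accepts T m) v : ℝ)}ᶜ ⊆
      Set.univ.pi fun s : Fin k => B s := by
    intro v hv s _
    by_contra hs
    simp only [hB] at hs
    split_ifs at hs with hcase
    · obtain ⟨i, hi⟩ := exists_eq_maxReward (v s)
      have hacc : accepts T m s (v s i) := by
        rw [accepts, if_neg (by omega)]
        refine ⟨by omega, ?_⟩
        rw [← hi]
        exact not_lt.1 hs
      obtain ⟨s', hs', i', h1, h2⟩ := exists_scan_eq hacc
      refine hv ?_
      change t < (scan (accepts T m) v : ℝ)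
      rw [h2]
      have hs'' : (s' : ℕ) ≤ s := hs'
      unfold accepts at h1
      split_ifs at h1
      · exact h0.trans h1
      · exact (hlt' s' (by omega)).trans_le h1.2
    · exact hs trivial
  have hmeas : MeasurableSet {v : Fin k → Fin n → ℝ≥0 | t < (scan (accepts T m) v : ℝ)} :=
    (measurable_coe_nnreal_real.comp (measurable_scan (measurableSet_accepts T m))) measurableSet_Ioi
  have h1 := measureReal_mono (μ := Measure.pi fun _ : Fin k => F) hsub
  rw [probReal_compl_eq_one_sub hmeas, real_pi_univ_pi,
    Fin.prod_univ_eq_prod_range (fun s => F.real (B s)) k] at h1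
  suffices hprod : ∏ s ∈ Finset.range k, F.real (B s) ≤ p ^ 2 ^ l by linarith
  obtain ⟨d, rfl⟩ := Nat.exists_eq_add_of_le hk
  rw [Finset.prod_range_add, ← mul_prod_pow_two_pow]
  have hle1 : ∀ s, F.real (B s) ≤ 1 := fun s => measureReal_le_one
  have hfirst : ∏ s ∈ Finset.range (l + 3), F.real (B s) ≤ p * ∏ i ∈ Finset.range l, p ^ 2 ^ i := by
    rw [add_comm l 3, Finset.prod_range_add]
    refine mul_le_mul ?_ ?_ (Finset.prod_nonneg fun _ _ => measureReal_nonneg) hp0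
    · simp [Finset.prod_range_succ, hB, hp]
    · refine Finset.prod_le_prod (fun _ _ => measureReal_nonneg) fun i hi => ?_
      have hi' := Finset.mem_range.1 hi
      have : B (3 + i) = {v | (maxReward v : ℝ) < T i} := by
        simp only [hB]
        rw [if_pos (by omega), Nat.add_sub_cancel_left]
      rw [this]
      rcases Nat.eq_zero_or_pos i with rfl | hpos
      · simp [hp]
      · exact (hT.2 i hpos).1
  calc _ ≤ (p * ∏ i ∈ Finset.range l, p ^ 2 ^ i) * 1 :=
        mul_le_mul hfirst (Finset.prod_le_one (fun _ _ => measureReal_nonneg) fun _ _ => hle1 _)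
          (Finset.prod_nonneg fun _ _ => measureReal_nonneg)
          (mul_nonneg hp0 (Finset.prod_nonneg fun _ _ => pow_nonneg hp0 _))
    _ = _ := mul_one _

/-- The tail of the algorithm's value is at least `1 - ε` times the tail of the maximum. -/
lemma mul_real_lt_maxReward_le [NeZero n] (hF : F ∈ pairwiseIndependent n) {T : ℕ → ℝ}
    (hT : AreThresholds F T) {ε : ℝ} (hε0 : 0 < ε) (hε1 : ε < 1) {m : ℕ} (hm : 0 < m)
    (hk : m + 2 ≤ k) (hpow : (1 / (1 + xi)) ^ 2 ^ (m - 1) ≤ ε) (t : ℝ) :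
    (1 - ε) * F.real {v | t < (maxReward v : ℝ)} ≤
      (Measure.pi fun _ : Fin k => F).real {v | t < (scan (accepts T m) v : ℝ)} := by
  have := hF.1
  have hle : (1 - ε) * F.real {v | t < (maxReward v : ℝ)} ≤ F.real {v | t < (maxReward v : ℝ)} :=
    mul_le_of_le_one_left measureReal_nonneg (by linarith)
  rcases le_or_gt (T 0) t with ht | ht
  · exact hle.trans (real_lt_maxReward_le_of_le hF hT m (by omega) ht)
  -- The last of the `m` rounds has index `m - 2` when `m ≥ 2`, so these are the thresholds in use.
  by_cases hex : ∃ l, l < m - 1 ∧ T l ≤ t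
  · classical
    obtain ⟨h1, h2⟩ := Nat.find_spec hex
    set l := Nat.find hex with hl
    have hmin : ∀ i < l, t < T i := by
      intro i hi
      have := Nat.find_min hex hi
      push Not at this
      exact this (hi.trans h1)
    have hl0 : 1 ≤ l := by
      rcases Nat.eq_zero_or_pos l with h | h
      · rw [h] at h2
        exact absurd h2 (not_le.2 ht)
      · exact h
    refine hle.trans (le_trans ?_
      -- No factor `1 - ε` is lost here: p^(2^l) bounds the failure probability from above and
      -- Pr[max ≤ `T l`] from below.
      (one_sub_pow_le_real_lt_scan hF hT (l := l) (by omega) (by omega) ht hmin))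
    have h3 := (hT.2 l hl0).2
    have h4 := probReal_compl_eq_one_sub (μ := F)
      (measurable_coe_maxReward (measurableSet_Iic (a := T l)))
    rw [← Set.preimage_compl, Set.compl_Iic] at h4
    have h5 : F.real {v | t < (maxReward v : ℝ)} ≤ F.real {v | T l < (maxReward v : ℝ)} :=
      measureReal_mono fun v hv => h2.trans_lt hv
    exact h5.trans (h4.trans_le (sub_le_sub_left h3 1))
  · push Not at hex
    refine le_trans ?_
      (one_sub_pow_le_real_lt_scan hF hT (l := m - 1) (by omega) (by omega) ht hex)
    have hp : F.real {v | (maxReward v : ℝ) < T 0} ≤ 1 / (1 + xi) :=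
      (measureReal_mono fun v hv i => not_le.2 ((le_maxReward v i).trans_lt hv)).trans
        (real_forall_notMem_le hF measurableSet_Ici xi_pos hT.1.2)
    have h6 := (pow_le_pow_left₀ measureReal_nonneg hp (2 ^ (m - 1))).trans hpow
    have h7 : (1 - ε) * F.real {v | t < (maxReward v : ℝ)} ≤ 1 - ε :=
      mul_le_of_le_one_right (by linarith) measureReal_le_one
    linarith

lemma lintegral_coe_eq_lintegral_meas_lt {Ω : Type*} [MeasurableSpace Ω] (μ : Measure Ω)
    {f : Ω → ℝ≥0} (hf : Measurable f) :
    ∫⁻ ω, (f ω : ℝ≥0∞) ∂μ = ∫⁻ t in Set.Ioi (0 : ℝ), μ {ω | t < (f ω : ℝ)} := by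
  rw [← lintegral_eq_lintegral_meas_lt μ (Eventually.of_forall fun ω => NNReal.coe_nonneg (f ω))
    (measurable_coe_nnreal_real.comp hf).aemeasurable]
  simp

lemma suffices_twoPhase [NeZero n] {T : Measure (Fin n → ℝ≥0) → ℕ → ℝ}
    (hT : ∀ F ∈ pairwiseIndependent n, AreThresholds F (T F)) {ε : ℝ} (hε0 : 0 < ε)
    (hε1 : ε < 1) (hr : -1 ≤ rounds ε) :
    Suffices (pairwiseIndependent n) (twoPhase n T ε) ε (rounds ε + 4).toNat := by
  intro F hF k hk
  have := hF.1
  have hscan := measurable_scan (n := n) (k := k)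
    (measurableSet_accepts (T F) (rounds ε + 2).toNat)
  unfold twoPhase
  rw [lintegral_coe_eq_lintegral_meas_lt F measurable_maxReward,
    lintegral_coe_eq_lintegral_meas_lt _ hscan,
    ← lintegral_const_mul' _ _ ENNReal.ofReal_ne_top]
  -- Both expectations are now integrals of tails, which also covers infinite expectations.
  refine lintegral_mono fun t => ?_
  have h := mul_real_lt_maxReward_le hF (hT F hF) hε0 hε1 (m := (rounds ε + 2).toNat)
    (by omega) (k := k) (by omega) (inv_one_add_xi_pow_le hε0 hε1 hr) t
  have h' := ENNReal.ofReal_le_ofReal h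
  rwa [ENNReal.ofReal_mul (by linarith), ofReal_measureReal, ofReal_measureReal] at h'

end Rounds

end Prophet

theorem theorem3 (n : ℕ) (hn : 0 < n) (ε : ℝ) (hε0 : 0 < ε) (hε1 : ε < 1)
    (hr : -1 ≤ Prophet.rounds ε) :
    (∀ F ∈ Prophet.pairwiseIndependent n, ∃ T : ℕ → ℝ, Prophet.AreThresholds F T) ∧
    ∀ T : Measure (Fin n → ℝ≥0) → ℕ → ℝ,
      (∀ F ∈ Prophet.pairwiseIndependent n, Prophet.AreThresholds F (T F)) →
      Prophet.competitionComplexity (Prophet.pairwiseIndependent n) (Prophet.twoPhase n T ε) ε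
        ≤ ((Prophet.rounds ε + 4).toNat : ℕ∞) := by
  have : NeZero n := ⟨hn.ne'⟩
  refine ⟨fun F hF => Prophet.exists_areThresholds hF, fun T hT => ?_⟩
  exact iInf₂_le _ ⟨by omega, Prophet.suffices_twoPhase hT hε0 hε1 hr⟩
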